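/- Let $\varphi(z)=\frac1{\sqrt{2\pi}}e^{-z^2/2}$ and $\Psi(z)=\int_z^{\infty}\varphi(w)\,dw$ for $z\in\mathbb C$, where the integral of the entire function $\varphi$ is taken along a path from $z$ to the point $\infty=\infty+0i$ of the extended real axis (so that $\varphi$ and $\Psi$ extend the density and the tail function of the standard normal distribution to entire functions), and let $R=\varphi/\Psi$ be the inverse Mills ratio. Then $\Psi$ has no zeros in the open half-plane $\{z\in\mathbb C:\operatorname{Re}z>0\}$, so that $R$ is holomorphic there, and its derivatives satisfy the following. For every integer $n\ge0$ and every $z\in\mathbb C$ with $x:=\operatorname{Re}z>0$, $$\big|R^{(n)}(z)\big|\le\frac{n!}{x^n}\sqrt{\big|z+\sqrt{2/\pi}\big|^2+x^2}.$$ Moreover, for every integer $n\ge1$, $$\frac{\big|R^{(n)}(z)-\mathbf 1_{\{n=1\}}\big|}{|z|/x^n}\longrightarrow0\quad\text{as } x=\operatorname{Re}z\to\infty,\ z\in\mathbb C,$$ uniformly in $\operatorname{Im}z$, where $\mathbf 1_{\{n=1\}}$ equals $1$ if $n=1$ and $0$ otherwise. -/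

import Mathlib

open Filter Topology

noncomputable section

/-- The standard normal density, extended to an entire function:
`φ(z) = exp (-z² / 2) / √(2π)`. -/
def normalDensity (z : ℂ) : ℂ :=
  (1 / (Real.sqrt (2 * Real.pi) : ℂ)) * Complex.exp (-z ^ 2 / 2)

/-- The tail function of the standard normal distribution, extended to an entire function:
`∫ φ(w) dw` from `z` to `∞ + 0i`. Since `φ` is entire, the integral does not depend on the path;
it is taken over the vertical segment from `z = x + iy` to `x`, followed by the
half-line `[x, ∞)` of the real axis. -/
def normalTail (z : ℂ) : ℂ :=
  (∫ u in Set.Ioi z.re, normalDensity (u : ℂ)) -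
    Complex.I * ∫ v in (0 : ℝ)..z.im, normalDensity ((z.re : ℂ) + (v : ℂ) * Complex.I)

/-- The inverse Mills ratio `R = φ / (tail function)`. -/
def inverseMills (z : ℂ) : ℂ :=
  normalDensity z / normalTail z

end

/-! Write `M` for `millsMoment 0`, c = √(2/π) and x = Re z. Since φ·`M` is a primitive of −φ
vanishing at +∞, Ψ = φ·`M` and R = 1/`M`. Integration by parts gives z·`M`(z) − 1 = O(1/|z|) on the
closed right half-plane.

On the imaginary axis φ > 0 and Re Ψ = 1/2, so Re `M` > 0 there. Phragmén–Lindelöf applied to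
exp(−`M`) carries Re `M` ≥ 0 into the half-plane, and the maximum principle then excludes zeros
(`MillsMoment.ne_zero`).

The pointwise bound |R(z)| ≤ |z + c| is a real inequality on the imaginary axis
(`exp_sq_le_mul_integral_sq`). It extends inside by Phragmén–Lindelöf for R/(z + c), which is
bounded near infinity (`norm_inverseMills_le`). Cauchy's formula on the circle of radius x about z
bounds R⁽ⁿ⁾(z) by n!/xⁿ times the mean of |ζ + c|, which is at most the root mean square √(|z + c|²
+ x²).

For the asymptotics, R − z is bounded near infinity in the half-plane, so Cauchy's estimate at
radius x/2 makes its n-th derivative O(x⁻ⁿ), which is o(|z|/xⁿ). -/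

open MeasureTheory Set in
/-- The integrals `∫ t ^ k * exp (-z * t - t² / 2) dt` over `(0, ∞)`. -/
noncomputable def millsMoment (k : ℕ) (z : ℂ) : ℂ :=
  ∫ t in Ioi (0 : ℝ), (t : ℂ) ^ k * Complex.exp (-z * t - (t : ℂ) ^ 2 / 2)

/-! ### Moment integrals: bounds, derivative, recurrences -/

namespace MillsMoment

open MeasureTheory Set

theorem norm_integrand (k : ℕ) (z : ℂ) {t : ℝ} (ht : 0 ≤ t) :
    ‖(t : ℂ) ^ k * Complex.exp (-z * t - (t : ℂ) ^ 2 / 2)‖ =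
      t ^ k * Real.exp (-z.re * t - t ^ 2 / 2) := by
  have h : (-z * t - (t : ℂ) ^ 2 / 2).re = -z.re * t - t ^ 2 / 2 := by
    rw [show (t : ℂ) ^ 2 / 2 = ((t ^ 2 / 2 : ℝ) : ℂ) by push_cast; rfl]
    simp only [Complex.sub_re, Complex.mul_re, Complex.neg_re, Complex.ofReal_re,
      Complex.ofReal_im, mul_zero, sub_zero]
  rw [norm_mul, norm_pow, Complex.norm_exp, h, Complex.norm_of_nonneg ht]

theorem integrable_exp_linear_sub_sq (a : ℝ) :
    Integrable fun t : ℝ => Real.exp (a * t - t ^ 2 / 2) := by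
  have h := (integrable_cexp_quadratic' (b := (-1 / 2 : ℂ)) (by norm_num) (a : ℂ) 0).norm
  refine h.congr (Eventually.of_forall fun t => ?_)
  simp only [Complex.norm_exp]
  congr 1
  rw [show (-1 / 2 * (t : ℂ) ^ 2 + a * t + 0) = ((-1 / 2 * t ^ 2 + a * t : ℝ) : ℂ) by
    push_cast; ring, Complex.ofReal_re]
  ring

theorem integrableOn_real (k : ℕ) (a : ℝ) :
    IntegrableOn (fun t : ℝ => t ^ k * Real.exp (a * t - t ^ 2 / 2)) (Ioi 0) := by
  -- The shift from a to a + 1 absorbs the power, by t ^ k ≤ k! * exp t.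
  have h := ((integrable_exp_linear_sub_sq (a + 1)).const_mul (k.factorial : ℝ)).integrableOn
    (s := Ioi 0)
  refine Integrable.mono' h (by fun_prop) ?_
  filter_upwards [ae_restrict_mem measurableSet_Ioi] with t ht
  have ht : 0 < t := ht
  rw [Real.norm_of_nonneg (by positivity),
    show (a + 1) * t - t ^ 2 / 2 = t + (a * t - t ^ 2 / 2) by ring, Real.exp_add, ← mul_assoc]
  gcongr
  have := Real.pow_div_factorial_le_exp t ht.le k
  rwa [div_le_iff₀' (by positivity)] at this

theorem integrableOn_integrand (k : ℕ) (z : ℂ) :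
    IntegrableOn (fun t : ℝ => (t : ℂ) ^ k * Complex.exp (-z * t - (t : ℂ) ^ 2 / 2)) (Ioi 0) := by
  refine Integrable.mono' (integrableOn_real k (-z.re)) (by fun_prop) ?_
  filter_upwards [ae_restrict_mem measurableSet_Ioi] with t ht
  exact (norm_integrand k z (le_of_lt ht)).le

theorem exists_norm_le (k : ℕ) :
    ∃ C : ℝ, 0 < C ∧ ∀ z : ℂ, 0 ≤ z.re → ‖millsMoment k z‖ ≤ C := by
  refine ⟨(∫ t in Ioi (0 : ℝ), t ^ k * Real.exp (0 * t - t ^ 2 / 2)) + 1, ?_, fun z hz => ?_⟩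
  · have : 0 ≤ ∫ t in Ioi (0 : ℝ), t ^ k * Real.exp (0 * t - t ^ 2 / 2) :=
      setIntegral_nonneg measurableSet_Ioi fun t ht => by
        have ht : 0 < t := ht
        positivity
    linarith
  refine le_trans ?_ (le_add_of_nonneg_right zero_le_one)
  refine norm_integral_le_of_norm_le (integrableOn_real k 0) ?_
  filter_upwards [ae_restrict_mem measurableSet_Ioi] with t ht
  have ht : 0 < t := ht
  rw [norm_integrand k z ht.le]
  gcongr
  linarith

theorem hasDerivAt_zero (z : ℂ) : HasDerivAt (millsMoment 0) (-millsMoment 1 z) z := by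
  have h := hasDerivAt_integral_of_dominated_loc_of_deriv_le
    (μ := volume.restrict (Ioi (0 : ℝ))) (s := Metric.ball z 1) (x₀ := z)
    (F := fun (w : ℂ) (t : ℝ) => (t : ℂ) ^ 0 * Complex.exp (-w * t - (t : ℂ) ^ 2 / 2))
    (F' := fun (w : ℂ) (t : ℝ) => -((t : ℂ) ^ 1 * Complex.exp (-w * t - (t : ℂ) ^ 2 / 2)))
    -- On the unit ball about z, Re w ≥ Re z − 1.
    (bound := fun t => t ^ 1 * Real.exp ((1 - z.re) * t - t ^ 2 / 2))
    (Metric.ball_mem_nhds z one_pos) (Eventually.of_forall fun w => by fun_prop)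
    (integrableOn_integrand 0 z) (by fun_prop) ?_ (integrableOn_real 1 _) ?_
  · have h2 := h.2
    rw [integral_neg] at h2
    exact h2
  · filter_upwards [ae_restrict_mem measurableSet_Ioi] with t ht w hw
    have ht : 0 < t := ht
    rw [norm_neg, norm_integrand 1 w ht.le]
    have h1 : |(w - z).re| ≤ ‖w - z‖ := Complex.abs_re_le_norm _
    have h2 : ‖w - z‖ < 1 := by simpa [dist_eq_norm] using hw
    rw [Complex.sub_re] at h1
    have := (abs_le.1 (h1.trans h2.le)).1
    gcongr
    linarith
  · refine Eventually.of_forall fun t w _ => ?_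
    have h1 : HasDerivAt (fun w : ℂ => -w * t - (t : ℂ) ^ 2 / 2) (-1 * (t : ℂ)) w :=
      ((hasDerivAt_neg w).mul_const (t : ℂ)).sub_const _
    have h2 := h1.cexp
    simp only [pow_zero, one_mul]
    convert! h2 using 1
    ring

theorem hasDerivAt_exp (z : ℂ) (t : ℝ) :
    HasDerivAt (fun t : ℝ => Complex.exp (-z * t - (t : ℂ) ^ 2 / 2))
      (-(z + t) * Complex.exp (-z * t - (t : ℂ) ^ 2 / 2)) t := by
  have h0 : HasDerivAt (fun s : ℂ => -z * s - s ^ 2 / 2) (-z - t) (t : ℂ) := by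
    have := ((hasDerivAt_id (t : ℂ)).const_mul (-z)).sub
      (((hasDerivAt_id (t : ℂ)).pow 2).div_const 2)
    convert! this using 1
    simp
  convert! h0.cexp.comp_ofReal using 1
  ring

/-- Integrate the derivative of exp(−zt − t²/2) over (0, ∞); the boundary value at 0 supplies the 1.
-/
theorem mul_zero_eq (z : ℂ) : z * millsMoment 0 z = 1 - millsMoment 1 z := by
  have hint := ((integrableOn_integrand 0 z).const_mul (-z)).sub (integrableOn_integrand 1 z)
  have hd : ∀ t ∈ Ici (0 : ℝ), HasDerivAt
      (fun t : ℝ => Complex.exp (-z * t - (t : ℂ) ^ 2 / 2))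
      (-z * ((t : ℂ) ^ 0 * Complex.exp (-z * t - (t : ℂ) ^ 2 / 2)) -
        (t : ℂ) ^ 1 * Complex.exp (-z * t - (t : ℂ) ^ 2 / 2)) t := fun t _ => by
    convert! hasDerivAt_exp z t using 1
    ring
  have hf : IntegrableOn (fun t : ℝ => Complex.exp (-z * t - (t : ℂ) ^ 2 / 2)) (Ioi 0) := by
    simpa using integrableOn_integrand 0 z
  have hlim := tendsto_zero_of_hasDerivAt_of_integrableOn_Ioi
    (fun t ht => hd t (Ioi_subset_Ici_self ht)) hint hf
  have h := integral_Ioi_of_hasDerivAt_of_tendsto' hd hint hlim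
  rw [integral_sub ((integrableOn_integrand 0 z).const_mul (-z)) (integrableOn_integrand 1 z),
    integral_const_mul] at h
  change -z * millsMoment 0 z - millsMoment 1 z = _ at h
  simp at h
  linear_combination -h

/-- The same with t·exp(−zt − t²/2), whose boundary values both vanish. -/
theorem mul_one_eq (z : ℂ) : z * millsMoment 1 z = millsMoment 0 z - millsMoment 2 z := by
  have hint01 : IntegrableOn (fun t : ℝ => (t : ℂ) ^ 0 * Complex.exp (-z * t - (t : ℂ) ^ 2 / 2) -
      z * ((t : ℂ) ^ 1 * Complex.exp (-z * t - (t : ℂ) ^ 2 / 2))) (Ioi 0) :=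
    (integrableOn_integrand 0 z).sub ((integrableOn_integrand 1 z).const_mul z)
  have hint := hint01.sub (integrableOn_integrand 2 z)
  have hd : ∀ t ∈ Ici (0 : ℝ), HasDerivAt
      (fun t : ℝ => (t : ℂ) ^ 1 * Complex.exp (-z * t - (t : ℂ) ^ 2 / 2))
      (((t : ℂ) ^ 0 * Complex.exp (-z * t - (t : ℂ) ^ 2 / 2) -
        z * ((t : ℂ) ^ 1 * Complex.exp (-z * t - (t : ℂ) ^ 2 / 2))) -
        (t : ℂ) ^ 2 * Complex.exp (-z * t - (t : ℂ) ^ 2 / 2)) t := fun t _ => by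
    have h1 : HasDerivAt (fun t : ℝ => (t : ℂ)) 1 t := Complex.ofRealCLM.hasDerivAt
    simp only [pow_one]
    convert! h1.mul (hasDerivAt_exp z t) using 1
    ring
  have hlim := tendsto_zero_of_hasDerivAt_of_integrableOn_Ioi
    (fun t ht => hd t (Ioi_subset_Ici_self ht)) hint (integrableOn_integrand 1 z)
  have h := integral_Ioi_of_hasDerivAt_of_tendsto' hd hint hlim
  rw [integral_sub hint01 (integrableOn_integrand 2 z),
    integral_sub (integrableOn_integrand 0 z) ((integrableOn_integrand 1 z).const_mul z),
    integral_const_mul] at h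
  change (millsMoment 0 z - z * millsMoment 1 z) - millsMoment 2 z = _ at h
  simp at h
  linear_combination -h

/-- `z * M(z) → 1` at rate `1 / ‖z‖` in the right half-plane. -/
theorem exists_norm_mul_sub_one_le :
    ∃ C : ℝ, 0 < C ∧ ∀ z : ℂ, 0 ≤ z.re → ‖z‖ * ‖z * millsMoment 0 z - 1‖ ≤ C := by
  obtain ⟨C₀, h0, H0⟩ := exists_norm_le 0
  obtain ⟨C₂, h2, H2⟩ := exists_norm_le 2
  refine ⟨C₀ + C₂, by positivity, fun z hz => ?_⟩
  rw [mul_zero_eq, sub_sub_cancel_left, norm_neg, ← norm_mul, mul_one_eq]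
  exact (norm_sub_le _ _).trans (add_le_add (H0 z hz) (H2 z hz))

theorem re_ofReal_pos (x : ℝ) : 0 < (millsMoment 0 (x : ℂ)).re := by
  have h : millsMoment 0 (x : ℂ) =
      ((∫ t in Ioi (0 : ℝ), Real.exp (-x * t - t ^ 2 / 2) : ℝ) : ℂ) := by
    rw [← integral_complex_ofReal]
    simp [millsMoment]
  rw [h, Complex.ofReal_re]
  have hi : IntegrableOn (fun t : ℝ => Real.exp (-x * t - t ^ 2 / 2)) (Ioi 0) := by
    simpa using integrableOn_real 0 (-x)
  refine (setIntegral_pos_iff_support_of_nonneg_ae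
    (Eventually.of_forall fun t => (Real.exp_pos _).le) hi).2 ?_
  have : Function.support (fun t : ℝ => Real.exp (-x * t - t ^ 2 / 2)) = univ :=
    Function.support_eq_univ fun t => (Real.exp_pos _).ne'
  rw [this]
  simp

end MillsMoment

/-! ### The tail as density times Mills ratio -/

section

open MeasureTheory Set MillsMoment

theorem normalDensity_ne_zero (z : ℂ) : normalDensity z ≠ 0 := by
  have : Real.sqrt (2 * Real.pi) ≠ 0 := by positivity
  simp only [normalDensity]
  exact mul_ne_zero (one_div_ne_zero (by exact_mod_cast this)) (Complex.exp_ne_zero _)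

theorem hasDerivAt_normalDensity (z : ℂ) :
    HasDerivAt normalDensity (-z * normalDensity z) z := by
  have h0 : HasDerivAt (fun s : ℂ => -s ^ 2 / 2) (-z) z := by
    convert! ((hasDerivAt_pow 2 z).neg.div_const 2) using 1
    simp only [Nat.cast_ofNat, Nat.add_one_sub_one, pow_one]
    ring
  unfold normalDensity
  convert! h0.cexp.const_mul _ using 1
  ring

theorem normalDensity_ofReal (x : ℝ) :
    normalDensity (x : ℂ) =
      ((1 / Real.sqrt (2 * Real.pi) * Real.exp (-(1 / 2) * x ^ 2) : ℝ) : ℂ) := by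
  simp only [normalDensity]
  push_cast
  congr 2
  ring

theorem normalDensity_ofReal_mul_I (x : ℝ) :
    normalDensity (x * Complex.I) =
      ((1 / Real.sqrt (2 * Real.pi) * Real.exp (x ^ 2 / 2) : ℝ) : ℂ) := by
  simp only [normalDensity]
  push_cast
  rw [mul_pow, Complex.I_sq]
  congr 2
  ring

theorem integrable_normalDensity_ofReal : Integrable fun u : ℝ => normalDensity (u : ℂ) := by
  simp only [normalDensity_ofReal]
  exact ((integrable_exp_neg_mul_sq (by norm_num : (0 : ℝ) < 1 / 2)).const_mul _).ofReal

/-- The product rule gives −φ times z * `millsMoment 0 z` + `millsMoment 1 z`, and that sum is 1. -/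
theorem hasDerivAt_normalDensity_mul_millsMoment (z : ℂ) :
    HasDerivAt (fun w => normalDensity w * millsMoment 0 w) (-normalDensity z) z := by
  convert! (hasDerivAt_normalDensity z).mul (MillsMoment.hasDerivAt_zero z) using 1
  linear_combination (normalDensity z) * (mul_zero_eq z)

theorem tendsto_normalDensity_ofReal :
    Tendsto (fun x : ℝ => normalDensity (x : ℂ)) atTop (𝓝 0) := by
  refine tendsto_zero_of_hasDerivAt_of_integrableOn_Ioi (a := 0)
    (fun x _ => (hasDerivAt_normalDensity (x : ℂ)).comp_ofReal) ?_
    integrable_normalDensity_ofReal.integrableOn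
  refine Integrable.integrableOn ?_
  have h := ((integrable_mul_exp_neg_mul_sq (by norm_num : (0 : ℝ) < 1 / 2)).const_mul
    (-(1 / Real.sqrt (2 * Real.pi)))).ofReal (𝕜 := ℂ)
  refine h.congr (Eventually.of_forall fun x => ?_)
  beta_reduce
  rw [RCLike.ofReal_eq_complex_ofReal, normalDensity_ofReal, ← Complex.ofReal_neg, ← Complex.ofReal_mul]
  refine Complex.ofReal_inj.2 ?_
  ring

/-- The tail function is the density times the Mills ratio `∫ exp (-z * t - t² / 2) dt`. -/
theorem normalTail_eq (z : ℂ) : normalTail z = normalDensity z * millsMoment 0 z := by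
  set P : ℂ → ℂ := fun w => normalDensity w * millsMoment 0 w with hP
  -- The primitive vanishes at +∞ because the Mills ratio is bounded there and φ tends to 0.
  have hreal : ∫ u in Ioi z.re, normalDensity (u : ℂ) = P z.re := by
    obtain ⟨C, -, hC⟩ := exists_norm_le 0
    have hlim : Tendsto (fun x : ℝ => P x) atTop (𝓝 0) := by
      refine squeeze_zero_norm' (a := fun x : ℝ => ‖normalDensity (x : ℂ)‖ * C) ?_ ?_
      · filter_upwards [eventually_ge_atTop 0] with x hx
        rw [hP, norm_mul]
        gcongr
        exact hC _ (by simpa using hx)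
      · simpa using tendsto_normalDensity_ofReal.norm.mul_const C
    have h := integral_Ioi_of_hasDerivAt_of_tendsto' (a := z.re)
      (fun x _ => (hasDerivAt_normalDensity_mul_millsMoment (x : ℂ)).comp_ofReal)
      integrable_normalDensity_ofReal.integrableOn.neg hlim
    rw [integral_neg] at h
    linear_combination -h
  have hvert : Complex.I * ∫ v in (0 : ℝ)..z.im,
      normalDensity ((z.re : ℂ) + (v : ℂ) * Complex.I) = P z.re - P z := by
    have hcont : Continuous normalDensity :=
      continuous_iff_continuousAt.2 fun w => (hasDerivAt_normalDensity w).continuousAt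
    have hd : ∀ v ∈ uIcc 0 z.im, HasDerivAt (fun v : ℝ => P ((z.re : ℂ) + (v : ℂ) * Complex.I))
        (-normalDensity ((z.re : ℂ) + (v : ℂ) * Complex.I) * Complex.I) v := fun v _ => by
      have h1 : HasDerivAt (fun v : ℂ => (z.re : ℂ) + v * Complex.I) Complex.I (v : ℂ) := by
        simpa using ((hasDerivAt_id (v : ℂ)).mul_const Complex.I).const_add (z.re : ℂ)
      exact (HasDerivAt.comp (v : ℂ)
        (hasDerivAt_normalDensity_mul_millsMoment ((z.re : ℂ) + (v : ℂ) * Complex.I))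
        h1).comp_ofReal
    have h := intervalIntegral.integral_eq_sub_of_hasDerivAt hd
      (Continuous.intervalIntegrable (by fun_prop) _ _)
    rw [intervalIntegral.integral_mul_const, intervalIntegral.integral_neg, Complex.re_add_im] at h
    simp only [Complex.ofReal_zero, zero_mul, add_zero] at h
    linear_combination -h
  rw [normalTail, hreal, hvert]
  ring

theorem inverseMills_eq_inv (z : ℂ) : inverseMills z = (millsMoment 0 z)⁻¹ := by
  rw [inverseMills, normalTail_eq, div_mul_eq_div_div, div_self (normalDensity_ne_zero z), one_div]

/-- The half-line contributes half the total mass and the vertical segment is purely imaginary, so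
Re Ψ is constant on the imaginary axis. Both the positivity of Re `M` and the bound on R there rest
on this. -/
theorem normalTail_ofReal_mul_I (y : ℝ) :
    normalTail (y * Complex.I) = ((1 / 2 : ℝ) : ℂ) -
      ((1 / Real.sqrt (2 * Real.pi) * ∫ v in (0 : ℝ)..y, Real.exp (v ^ 2 / 2) : ℝ) : ℂ) *
        Complex.I := by
  have h1 : ∫ u in Ioi (0 : ℝ), normalDensity (u : ℂ) = ((1 / 2 : ℝ) : ℂ) := by
    simp only [normalDensity_ofReal]
    rw [integral_complex_ofReal, integral_const_mul, integral_gaussian_Ioi,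
      show Real.pi / (1 / 2) = 2 * Real.pi by ring]
    congr 1
    have : Real.sqrt (2 * Real.pi) ≠ 0 := by positivity
    field_simp
  have h2 : ∫ v in (0 : ℝ)..y, normalDensity (v * Complex.I) =
      ((1 / Real.sqrt (2 * Real.pi) * ∫ v in (0 : ℝ)..y, Real.exp (v ^ 2 / 2) : ℝ) : ℂ) := by
    simp only [normalDensity_ofReal_mul_I]
    rw [intervalIntegral.integral_ofReal, intervalIntegral.integral_const_mul]
  simp only [normalTail, Complex.re_ofReal_mul, Complex.im_ofReal_mul, Complex.I_re, Complex.I_im,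
    mul_zero, mul_one, Complex.ofReal_zero, zero_add, h1, h2]
  ring

end

/-! ### The real inequality behind the bound on the imaginary axis -/

section

open Set

/-- A comparison of `exp (y² / 2)` with its primitive vanishing at the origin. -/
theorem exp_sq_half_mul_le_integral {a y : ℝ} (ha : 3 / 5 ≤ a) (ha1 : a ≤ 1) (hy : 0 ≤ y) :
    Real.exp (y ^ 2 / 2) * ((y ^ 3 + (a - 1) * y) / (y ^ 2 + a) ^ 2) ≤
      ∫ v in (0 : ℝ)..y, Real.exp (v ^ 2 / 2) := by
  have ha0 : 0 < a := by linarith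
  set g : ℝ → ℝ := fun y => (∫ v in (0 : ℝ)..y, Real.exp (v ^ 2 / 2)) -
    Real.exp (y ^ 2 / 2) * ((y ^ 3 + (a - 1) * y) / (y ^ 2 + a) ^ 2) with hg
  have hpos : ∀ s : ℝ, 0 < s ^ 2 + a := fun s => by positivity
  have hd : ∀ s : ℝ, HasDerivAt g (Real.exp (s ^ 2 / 2) *
      (((a + 2) * (s ^ 2) ^ 2 + (2 * a ^ 2 + a - 3) * s ^ 2 + (a ^ 3 - a ^ 2 + a)) /
        (s ^ 2 + a) ^ 3)) s := fun s => by
    have hs := (hpos s).ne'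
    have h1 : HasDerivAt (fun y => ∫ v in (0 : ℝ)..y, Real.exp (v ^ 2 / 2))
        (Real.exp (s ^ 2 / 2)) s :=
      intervalIntegral.integral_hasDerivAt_right
        (Continuous.intervalIntegrable (by fun_prop) _ _)
        (Continuous.stronglyMeasurableAtFilter (by fun_prop) _ _)
        (Continuous.continuousAt (by fun_prop))
    have h2 : HasDerivAt (fun y : ℝ => Real.exp (y ^ 2 / 2)) (Real.exp (s ^ 2 / 2) * s) s := by
      convert! ((hasDerivAt_pow 2 s).div_const 2).exp using 1
      simp
    have h3 : HasDerivAt (fun y : ℝ => y ^ 3 + (a - 1) * y) (3 * s ^ 2 + (a - 1)) s := by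
      convert! (hasDerivAt_pow 3 s).add ((hasDerivAt_id s).const_mul (a - 1)) using 1
      simp
    have h4 : HasDerivAt (fun y : ℝ => (y ^ 2 + a) ^ 2) (2 * (s ^ 2 + a) * (2 * s)) s := by
      convert! ((hasDerivAt_pow 2 s).add_const a).pow 2 using 1
      simp
    convert! h1.sub (h2.mul (h3.div h4 (pow_ne_zero 2 hs))) using 1
    simp only [Pi.div_apply]
    field_simp
    ring
  have hmono : MonotoneOn g (Ici 0) := by
    refine monotoneOn_of_hasDerivWithinAt_nonneg (convex_Ici 0)
      (fun s _ => (hd s).continuousAt.continuousWithinAt)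
      (fun s _ => (hd s).hasDerivWithinAt) fun s _ => ?_
    -- Each coefficient increases with a, so it is bounded below by its value at a = 3/5. The
    -- resulting quadratic in s² has negative discriminant and its vertex at 21/65.
    have hq : 0 ≤ (a + 2) * (s ^ 2) ^ 2 + (2 * a ^ 2 + a - 3) * s ^ 2 + (a ^ 3 - a ^ 2 + a) := by
      have h1 : (13 / 5) * (s ^ 2) ^ 2 ≤ (a + 2) * (s ^ 2) ^ 2 := by
        gcongr
        linarith
      have h2 : -(42 / 25) * s ^ 2 ≤ (2 * a ^ 2 + a - 3) * s ^ 2 := by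
        gcongr
        nlinarith
      have h3 : 57 / 125 ≤ a ^ 3 - a ^ 2 + a := by
        nlinarith [mul_nonneg (sub_nonneg.2 ha) (sq_nonneg a), sq_nonneg a]
      nlinarith [sq_nonneg (s ^ 2 - 21 / 65)]
    have := hpos s
    positivity
  have := hmono (mem_Ici.2 le_rfl) (mem_Ici.2 hy) hy
  simp only [hg, intervalIntegral.integral_same] at this
  norm_num at this
  exact this

/-- Equality holds at y = 0, and both sides are even. For y ≥ 0 the function E² − exp(y²)/(y² + a),
with E the integral, is nondecreasing: up to a positive factor its derivative is the difference in
`exp_sq_half_mul_le_integral`. -/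
theorem exp_sq_le_mul_integral_sq {a : ℝ} (ha : 3 / 5 ≤ a) (ha1 : a ≤ 1) (y : ℝ) :
    Real.exp (y ^ 2) ≤
      (y ^ 2 + a) * (1 / a + (∫ v in (0 : ℝ)..y, Real.exp (v ^ 2 / 2)) ^ 2) := by
  wlog hy : 0 ≤ y generalizing y
  · have h := this (-y) (by linarith)
    have h2 : ∫ v in (0 : ℝ)..(-y), Real.exp (v ^ 2 / 2) =
        -∫ v in (0 : ℝ)..y, Real.exp (v ^ 2 / 2) := by
      have := intervalIntegral.integral_comp_neg (a := 0) (b := y)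
        (fun v : ℝ => Real.exp (v ^ 2 / 2))
      simp only [neg_sq, neg_zero] at this
      rw [intervalIntegral.integral_symm, this]
    simpa only [neg_sq, h2] using h
  have ha0 : 0 < a := by linarith
  set E : ℝ → ℝ := fun y => ∫ v in (0 : ℝ)..y, Real.exp (v ^ 2 / 2) with hE
  set g : ℝ → ℝ := fun y => E y ^ 2 - Real.exp (y ^ 2) / (y ^ 2 + a) with hg
  have hpos : ∀ s : ℝ, 0 < s ^ 2 + a := fun s => by positivity
  have hexp : ∀ s : ℝ, Real.exp (s ^ 2) = Real.exp (s ^ 2 / 2) * Real.exp (s ^ 2 / 2) := fun s => by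
    rw [← Real.exp_add, add_halves]
  have hd : ∀ s : ℝ, HasDerivAt g (2 * Real.exp (s ^ 2 / 2) * (E s -
      Real.exp (s ^ 2 / 2) * ((s ^ 3 + (a - 1) * s) / (s ^ 2 + a) ^ 2))) s := fun s => by
    have hs := (hpos s).ne'
    have h1 : HasDerivAt E (Real.exp (s ^ 2 / 2)) s :=
      intervalIntegral.integral_hasDerivAt_right
        (Continuous.intervalIntegrable (by fun_prop) _ _)
        (Continuous.stronglyMeasurableAtFilter (by fun_prop) _ _)
        (Continuous.continuousAt (by fun_prop))
    have h2 : HasDerivAt (fun y : ℝ => Real.exp (y ^ 2)) (Real.exp (s ^ 2) * (2 * s)) s := by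
      convert! (hasDerivAt_pow 2 s).exp using 1
      simp
    have h3 : HasDerivAt (fun y : ℝ => y ^ 2 + a) (2 * s) s := by
      simpa using (hasDerivAt_pow 2 s).add_const a
    convert! (h1.pow 2).sub (h2.div h3 hs) using 1
    rw [hexp]
    field_simp
    ring
  have hmono : MonotoneOn g (Ici 0) := by
    refine monotoneOn_of_hasDerivWithinAt_nonneg (convex_Ici 0)
      (fun s _ => (hd s).continuousAt.continuousWithinAt)
      (fun s _ => (hd s).hasDerivWithinAt) fun s hs => ?_
    rw [interior_Ici] at hs
    have := exp_sq_half_mul_le_integral ha ha1 (le_of_lt (mem_Ioi.1 hs))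
    exact mul_nonneg (by positivity) (sub_nonneg.2 this)
  have h := hmono (mem_Ici.2 le_rfl) (mem_Ici.2 hy) hy
  simp only [hg, hE, intervalIntegral.integral_same] at h
  norm_num at h
  have hle : Real.exp (y ^ 2) / (y ^ 2 + a) ≤ 1 / a + E y ^ 2 := by
    rw [one_div]
    linarith
  rwa [div_le_iff₀' (hpos y)] at hle

end

/-! ### Phragmén–Lindelöf: nonvanishing and the bound on R -/

section

open Set MillsMoment Asymptotics Bornology

/-- A Phragmén–Lindelöf principle in the right half-plane for functions bounded near infinity. -/
theorem norm_le_of_bounded_near_infinity {f : ℂ → ℂ} {A K C : ℝ}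
    (hd : DiffContOnCl ℂ f {z | 0 < z.re}) (hA : ∀ z : ℂ, 0 < z.re → K ≤ ‖z‖ → ‖f z‖ ≤ A)
    (him : ∀ x : ℝ, ‖f (x * Complex.I)‖ ≤ C) {z : ℂ} (hz : 0 ≤ z.re) : ‖f z‖ ≤ C := by
  -- Exponent 1 < 2 with coefficient 0: the growth condition becomes plain boundedness near
  -- infinity.
  refine PhragmenLindelof.right_half_plane_of_bounded_on_real hd ⟨1, one_lt_two, 0, ?_⟩ ?_ him hz
  · refine IsBigO.of_bound A ?_
    have h1 : ∀ᶠ z : ℂ in cobounded ℂ ⊓ 𝓟 {z | 0 < z.re}, K ≤ ‖z‖ :=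
      (tendsto_norm_cobounded_atTop.eventually_ge_atTop K).filter_mono inf_le_left
    have h2 : ∀ᶠ z : ℂ in cobounded ℂ ⊓ 𝓟 {z | 0 < z.re}, 0 < z.re :=
      (eventually_principal.2 fun _ h => h).filter_mono inf_le_right
    filter_upwards [h1, h2] with w hw1 hw2
    simpa using hA w hw2 hw1
  · refine ⟨A, ?_⟩
    rw [eventually_map]
    filter_upwards [eventually_ge_atTop K, eventually_gt_atTop 0] with x hx hx0
    refine hA x (by simpa using hx0) ?_
    rwa [Complex.norm_of_nonneg hx0.le]

namespace MillsMoment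

theorem differentiable_zero : Differentiable ℂ (millsMoment 0) := fun z =>
  (hasDerivAt_zero z).differentiableAt

theorem re_ofReal_mul_I_pos (y : ℝ) : 0 < (millsMoment 0 (y * Complex.I)).re := by
  have h := congrArg Complex.re (normalTail_eq (y * Complex.I))
  rw [normalTail_ofReal_mul_I, normalDensity_ofReal_mul_I, Complex.re_ofReal_mul] at h
  simp only [Complex.sub_re, Complex.ofReal_re, Complex.re_ofReal_mul, Complex.I_re, mul_zero,
    sub_zero] at h
  have hp : 0 < 1 / Real.sqrt (2 * Real.pi) * Real.exp (y ^ 2 / 2) := by positivity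
  refine pos_of_mul_pos_right (a := 1 / Real.sqrt (2 * Real.pi) * Real.exp (y ^ 2 / 2)) ?_ hp.le
  rw [← h]
  norm_num

/-- This encodes Re `M` ≥ 0. Exponentiating turns the sign condition, known on the imaginary axis,
into a modulus bound that Phragmén–Lindelöf can propagate. -/
theorem norm_exp_neg_le_one {z : ℂ} (hz : 0 ≤ z.re) : ‖Complex.exp (-millsMoment 0 z)‖ ≤ 1 := by
  obtain ⟨C, -, hC⟩ := exists_norm_le 0
  refine norm_le_of_bounded_near_infinity (A := Real.exp C) (K := 0)
    (f := fun z => Complex.exp (-millsMoment 0 z))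
    (differentiable_zero.neg.cexp.diffContOnCl) (fun w hw _ => ?_) (fun y => ?_) hz
  · rw [Complex.norm_exp, Real.exp_le_exp]
    refine (Complex.re_le_norm _).trans ?_
    rw [norm_neg]
    exact hC w hw.le
  · rw [Complex.norm_exp, Real.exp_le_one_iff, Complex.neg_re]
    exact (neg_neg_of_pos (re_ofReal_mul_I_pos y)).le

/-- At an interior zero exp(−`M`) would attain its maximal modulus 1, hence be constant on the
half-plane; but `M`(1) has positive real part. On the boundary Re `M` > 0 directly. -/
theorem ne_zero {z : ℂ} (hz : 0 ≤ z.re) : millsMoment 0 z ≠ 0 := by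
  rcases hz.eq_or_lt with h | h
  · have hz' : z = (z.im : ℂ) * Complex.I := by
      conv_lhs => rw [← Complex.re_add_im z, ← h]
      simp
    rw [hz']
    intro h0
    have := re_ofReal_mul_I_pos z.im
    rw [h0, Complex.zero_re] at this
    exact lt_irrefl _ this
  · intro h0
    have hmax : IsMaxOn (norm ∘ fun w => Complex.exp (-millsMoment 0 w)) {w : ℂ | 0 < w.re} z :=
      fun w (hw : 0 < w.re) => by
        simpa [h0] using norm_exp_neg_le_one hw.le
    have heq := Complex.eqOn_of_isPreconnected_of_isMaxOn_norm
      (convex_halfSpace_re_gt 0).isPreconnected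
      (isOpen_lt continuous_const Complex.continuous_re)
      differentiable_zero.neg.cexp.differentiableOn h hmax
      (show ((1 : ℝ) : ℂ) ∈ {w : ℂ | 0 < w.re} by simp)
    have hn : ‖Complex.exp (-millsMoment 0 ((1 : ℝ) : ℂ))‖ = ‖Complex.exp (-millsMoment 0 z)‖ :=
      congrArg norm heq
    simp only [h0, neg_zero, Complex.exp_zero, norm_one, Complex.norm_exp,
      Real.exp_eq_one_iff, Complex.neg_re, neg_eq_zero] at hn
    exact (re_ofReal_pos 1).ne' hn

end MillsMoment

theorem differentiableAt_inverseMills {z : ℂ} (hz : 0 ≤ z.re) :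
    DifferentiableAt ℂ inverseMills z := by
  rw [show inverseMills = fun z => (millsMoment 0 z)⁻¹ from funext inverseMills_eq_inv]
  exact (differentiable_zero z).inv (ne_zero hz)

theorem analyticAt_inverseMills {z : ℂ} (hz : 0 < z.re) : AnalyticAt ℂ inverseMills z :=
  DifferentiableOn.analyticAt
    (fun _ hw => (differentiableAt_inverseMills (le_of_lt hw)).differentiableWithinAt)
    ((isOpen_lt continuous_const Complex.continuous_re).mem_nhds hz)

theorem exists_norm_inverseMills_le :
    ∃ K : ℝ, 0 < K ∧ ∀ z : ℂ, 0 ≤ z.re → K ≤ ‖z‖ → ‖inverseMills z‖ ≤ 2 * ‖z‖ := by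
  obtain ⟨C, hC0, hC⟩ := exists_norm_mul_sub_one_le
  refine ⟨2 * C, by positivity, fun z hz hK => ?_⟩
  have hz0 : 0 < ‖z‖ := by linarith
  have h1 : ‖z * millsMoment 0 z - 1‖ ≤ 1 / 2 := by
    have := hC z hz
    by_contra! hlt
    nlinarith
  have h2 : 1 / 2 ≤ ‖z‖ * ‖millsMoment 0 z‖ := by
    rw [← norm_mul]
    have := norm_sub_norm_le (1 : ℂ) (z * millsMoment 0 z)
    rw [norm_one, norm_sub_rev] at this
    linarith
  rw [inverseMills_eq_inv, norm_inv, inv_le_iff_one_le_mul₀ (norm_pos_iff.2 (ne_zero hz))]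
  linarith

/-- This is the real inequality with a = 2/π = c². For this a, (1/(2π))·(1/a) = 1/4, the square of
Re Ψ(iy), so the bound is sharp at y = 0. -/
theorem norm_inverseMills_ofReal_mul_I_le (y : ℝ) :
    ‖inverseMills (y * Complex.I)‖ ≤
      ‖(y : ℂ) * Complex.I + (Real.sqrt (2 / Real.pi) : ℂ)‖ := by
  have hpi := Real.pi_pos
  have ha : 3 / 5 ≤ 2 / Real.pi := by
    rw [le_div_iff₀ hpi]
    linarith [Real.pi_lt_d2]
  have ha1 : 2 / Real.pi ≤ 1 := by
    rw [div_le_one hpi]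
    exact Real.two_le_pi
  have key := exp_sq_le_mul_integral_sq ha ha1 y
  set E := ∫ v in (0 : ℝ)..y, Real.exp (v ^ 2 / 2) with hE
  set r := 1 / Real.sqrt (2 * Real.pi) with hr
  have hr2 : r ^ 2 = 1 / (2 * Real.pi) := by
    rw [hr, div_pow, Real.sq_sqrt (by positivity), one_pow]
  have hnum : ‖normalDensity (y * Complex.I)‖ ^ 2 = r ^ 2 * Real.exp (y ^ 2) := by
    rw [normalDensity_ofReal_mul_I, Complex.norm_real, Real.norm_eq_abs, sq_abs, mul_pow,
      ← Real.exp_nat_mul]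
    congr 2
    push_cast
    ring
  have hden : ‖normalTail (y * Complex.I)‖ ^ 2 = 1 / 4 + r ^ 2 * E ^ 2 := by
    rw [normalTail_ofReal_mul_I, Complex.sq_norm, Complex.normSq_apply]
    simp only [Complex.sub_re, Complex.sub_im, Complex.ofReal_re, Complex.ofReal_im,
      Complex.re_ofReal_mul, Complex.im_ofReal_mul, Complex.I_re, Complex.I_im, mul_zero, mul_one,
      sub_zero, zero_sub]
    ring
  have hrhs : ‖(y : ℂ) * Complex.I + (Real.sqrt (2 / Real.pi) : ℂ)‖ ^ 2 = y ^ 2 + 2 / Real.pi := by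
    rw [Complex.sq_norm, Complex.normSq_apply]
    simp only [Complex.add_re, Complex.re_ofReal_mul, Complex.I_re, mul_zero, Complex.ofReal_re,
      zero_add, Complex.add_im, Complex.im_ofReal_mul, Complex.I_im, mul_one, Complex.ofReal_im,
      add_zero, Real.mul_self_sqrt (show 0 ≤ 2 / Real.pi by positivity)]
    ring
  refine le_of_sq_le_sq ?_ (norm_nonneg _)
  rw [inverseMills, norm_div, div_pow, hnum, hden, hrhs, div_le_iff₀ (by positivity)]
  calc r ^ 2 * Real.exp (y ^ 2)
      ≤ r ^ 2 * ((y ^ 2 + 2 / Real.pi) * (1 / (2 / Real.pi) + E ^ 2)) := by gcongr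
    _ = (y ^ 2 + 2 / Real.pi) * (1 / 4 + r ^ 2 * E ^ 2) := by
      rw [hr2]
      field_simp
      ring

/-- The inverse Mills ratio is dominated by `‖z + √(2/π)‖` in the closed right half-plane. -/
theorem norm_inverseMills_le {z : ℂ} (hz : 0 ≤ z.re) :
    ‖inverseMills z‖ ≤ ‖z + (Real.sqrt (2 / Real.pi) : ℂ)‖ := by
  set c := Real.sqrt (2 / Real.pi) with hc
  have hc0 : 0 < c := by positivity
  have hpos : ∀ w : ℂ, 0 ≤ w.re → 0 < ‖w + c‖ := fun w hw => by
    refine norm_pos_iff.2 fun h => ?_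
    have := congrArg Complex.re h
    simp at this
    linarith
  obtain ⟨K, hK0, hK⟩ := exists_norm_inverseMills_le
  have hcl : closure {w : ℂ | 0 < w.re} = {w : ℂ | 0 ≤ w.re} := Complex.closure_setOfPred_lt_re 0
  -- The bound 2 comes from |R(w)| ≤ 2|w| for large w, together with |w| ≤ |w + c| when Re w ≥ 0.
  have h := norm_le_of_bounded_near_infinity (f := fun w => inverseMills w / (w + c))
    (A := 2) (K := K) (C := 1) ?_ ?_ ?_ hz
  · rwa [norm_div, div_le_one (hpos z hz)] at h
  · refine DifferentiableOn.diffContOnCl ?_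
    rw [hcl]
    intro w hw
    exact ((differentiableAt_inverseMills hw).div (by fun_prop)
      (norm_pos_iff.1 (hpos w hw))).differentiableWithinAt
  · intro w hw hKw
    rw [norm_div, div_le_iff₀ (hpos w hw.le)]
    refine (hK w hw.le hKw).trans ?_
    gcongr
    refine le_of_sq_le_sq ?_ (norm_nonneg _)
    rw [Complex.sq_norm, Complex.sq_norm, Complex.normSq_apply, Complex.normSq_apply]
    simp
    nlinarith
  · intro y
    rw [norm_div, div_le_one (hpos _ (by simp))]
    exact norm_inverseMills_ofReal_mul_I_le y

end

/-! ### Cauchy estimates for the derivatives -/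

section

open Set Metric

theorem norm_circleMap_add_sq (z c : ℂ) (r θ : ℝ) :
    ‖circleMap z r θ + c‖ ^ 2 =
      ‖z + c‖ ^ 2 + r ^ 2 + 2 * r * ((z + c).re * Real.cos θ + (z + c).im * Real.sin θ) := by
  have h : circleMap z r θ + c = (z + c) + (r * Real.cos θ : ℝ) + (r * Real.sin θ : ℝ) * Complex.I := by
    rw [circleMap, Complex.exp_mul_I]
    push_cast
    ring
  rw [h, Complex.sq_norm, Complex.sq_norm, Complex.normSq_apply, Complex.normSq_apply]
  simp only [Complex.add_re, Complex.add_im, Complex.ofReal_re, Complex.ofReal_im,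
    Complex.re_ofReal_mul, Complex.im_ofReal_mul, Complex.I_re, Complex.I_im, mul_zero, mul_one,
    add_zero]
  linear_combination r ^ 2 * Real.sin_sq_add_cos_sq θ

/-- Cauchy's estimate in mean square for functions dominated by `‖ζ + c‖` on a circle. -/
theorem norm_iteratedDeriv_le_of_norm_le_norm_add {f : ℂ → ℂ} {z c : ℂ} {r : ℝ} (n : ℕ)
    (hr : 0 < r) (hf : DiffContOnCl ℂ f (ball z r))
    (hle : ∀ ζ ∈ sphere z r, ‖f ζ‖ ≤ ‖ζ + c‖) :
    ‖iteratedDeriv n f z‖ ≤ n.factorial / r ^ n * Real.sqrt (‖z + c‖ ^ 2 + r ^ 2) := by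
  set S := Real.sqrt (‖z + c‖ ^ 2 + r ^ 2) with hS
  have hS0 : 0 < S := by positivity
  have hS2 : S ^ 2 = ‖z + c‖ ^ 2 + r ^ 2 := Real.sq_sqrt (by positivity)
  have hq : iteratedDeriv n f z = n.factorial • (2 * Real.pi * Complex.I)⁻¹ •
      ∮ w in C(z, r), (w - z)⁻¹ ^ (n + 1) • f w := by
    have : (2 * Real.pi * Complex.I / n.factorial) ≠ 0 := by simp [Nat.factorial_ne_zero]
    rw [← inv_smul_smul₀ this (iteratedDeriv n f z), inv_div, div_eq_inv_mul, mul_comm,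
      ← nsmul_eq_mul, smul_assoc]
    have h := DiffContOnCl.circleIntegral_one_div_sub_center_pow_smul hr n hf
    simp only [one_div, ← inv_pow] at h
    rw [h]
  -- Up to the factor r⁻ⁿ, this is (|ζ + c|² + S²)/(2S), which dominates |ζ + c| by AM-GM. As S² is
  -- the mean of |ζ + c|² over the circle, the trigonometric terms integrate to zero and no
  -- Cauchy–Schwarz for integrals is needed.
  set g : ℝ → ℝ := fun θ =>
    (r ^ n)⁻¹ * (S + r / S * ((z + c).re * Real.cos θ + (z + c).im * Real.sin θ)) with hg
  have hint : ∫ θ in (0 : ℝ)..2 * Real.pi, g θ = (r ^ n)⁻¹ * (2 * Real.pi * S) := by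
    have h1 : ∀ a : ℝ, IntervalIntegrable (fun θ => a * Real.cos θ) MeasureTheory.volume 0
        (2 * Real.pi) := fun a => Continuous.intervalIntegrable (by fun_prop) _ _
    have h2 : ∀ a : ℝ, IntervalIntegrable (fun θ => a * Real.sin θ) MeasureTheory.volume 0
        (2 * Real.pi) := fun a => Continuous.intervalIntegrable (by fun_prop) _ _
    simp only [hg]
    rw [intervalIntegral.integral_const_mul, intervalIntegral.integral_add (by simp)
      (((h1 _).add (h2 _)).const_mul _), intervalIntegral.integral_const_mul,
      intervalIntegral.integral_add (h1 _) (h2 _), intervalIntegral.integral_const_mul,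
      intervalIntegral.integral_const_mul, integral_cos, integral_sin]
    simp
  have hbound : ‖∮ w in C(z, r), (w - z)⁻¹ ^ (n + 1) • f w‖ ≤ (r ^ n)⁻¹ * (2 * Real.pi * S) := by
    rw [← hint]
    refine intervalIntegral.norm_integral_le_of_norm_le (by positivity)
      (Eventually.of_forall fun θ _ => ?_) (Continuous.intervalIntegrable (by fun_prop) _ _)
    have hfθ := hle _ (circleMap_mem_sphere z hr.le θ)
    have hsq := norm_circleMap_add_sq z c r θ
    have hamgm : ‖circleMap z r θ + c‖ ≤
        S + r / S * ((z + c).re * Real.cos θ + (z + c).im * Real.sin θ) := by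
      rw [← hS2] at hsq
      have := sq_nonneg (‖circleMap z r θ + c‖ - S)
      rw [← mul_le_mul_iff_right₀ hS0]
      have h3 : S * (S + r / S * ((z + c).re * Real.cos θ + (z + c).im * Real.sin θ)) =
          S ^ 2 + r * ((z + c).re * Real.cos θ + (z + c).im * Real.sin θ) := by
        field_simp
      rw [h3]
      nlinarith
    have hnorm : ‖deriv (circleMap z r) θ • ((circleMap z r θ - z)⁻¹ ^ (n + 1) •
        f (circleMap z r θ))‖ = (r ^ n)⁻¹ * ‖f (circleMap z r θ)‖ := by
      simp only [deriv_circleMap, circleMap_sub_center, norm_smul, norm_mul, norm_pow, norm_inv,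
        norm_circleMap_zero, Complex.norm_I, mul_one, abs_of_pos hr]
      rw [← mul_assoc, inv_pow, pow_succ]
      field_simp
    rw [hnorm]
    simp only [hg]
    gcongr
    exact hfθ.trans hamgm
  rw [hq, RCLike.norm_nsmul (K := ℂ), nsmul_eq_mul, norm_smul]
  have h2pi : ‖(2 * Real.pi * Complex.I : ℂ)⁻¹‖ = (2 * Real.pi)⁻¹ := by
    simp [abs_of_pos Real.pi_pos]
  rw [h2pi]
  calc (n.factorial : ℝ) * ((2 * Real.pi)⁻¹ * ‖∮ w in C(z, r), (w - z)⁻¹ ^ (n + 1) • f w‖)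
      ≤ n.factorial * ((2 * Real.pi)⁻¹ * ((r ^ n)⁻¹ * (2 * Real.pi * S))) := by gcongr
    _ = n.factorial / r ^ n * S := by
      have := Real.pi_pos.ne'
      field_simp

theorem re_nonneg_of_mem_closedBall {z w : ℂ} {r : ℝ} (hw : w ∈ closedBall z r) :
    z.re - r ≤ w.re := by
  have h1 := (abs_le.1 (Complex.abs_re_le_norm (w - z))).1
  rw [mem_closedBall, dist_eq_norm] at hw
  rw [Complex.sub_re] at h1
  linarith

theorem diffContOnCl_inverseMills {z : ℂ} {r : ℝ} (hr : r ≤ z.re) :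
    DiffContOnCl ℂ inverseMills (ball z r) :=
  DifferentiableOn.diffContOnCl fun w hw => by
    have := re_nonneg_of_mem_closedBall (closure_ball_subset_closedBall hw)
    exact (differentiableAt_inverseMills (by linarith)).differentiableWithinAt

/-- The radius is Re z itself. The circle touches the imaginary axis, so the bound on R is needed on
the closed half-plane. -/
theorem norm_iteratedDeriv_inverseMills_le (n : ℕ) {z : ℂ} (hz : 0 < z.re) :
    ‖iteratedDeriv n inverseMills z‖ ≤ (n.factorial : ℝ) / z.re ^ n *
      Real.sqrt (‖z + (Real.sqrt (2 / Real.pi) : ℂ)‖ ^ 2 + z.re ^ 2) := by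
  refine norm_iteratedDeriv_le_of_norm_le_norm_add n hz (diffContOnCl_inverseMills le_rfl)
    fun w hw => norm_inverseMills_le ?_
  have := re_nonneg_of_mem_closedBall (sphere_subset_closedBall hw)
  linarith

/-- In R − z = −R·(z`M` − 1), the linear growth of R cancels against the 1/|z| decay of z`M` − 1. -/
theorem exists_norm_inverseMills_sub_le :
    ∃ C K : ℝ, 0 < C ∧ 0 < K ∧
      ∀ z : ℂ, 0 ≤ z.re → K ≤ ‖z‖ → ‖inverseMills z - z‖ ≤ C := by
  obtain ⟨C, hC0, hC⟩ := MillsMoment.exists_norm_mul_sub_one_le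
  obtain ⟨K, hK0, hK⟩ := exists_norm_inverseMills_le
  refine ⟨2 * C, K, by positivity, hK0, fun z hz hKz => ?_⟩
  have h : inverseMills z - z = -(inverseMills z * (z * millsMoment 0 z - 1)) := by
    rw [inverseMills_eq_inv]
    have := MillsMoment.ne_zero hz
    field_simp
    ring
  rw [h, norm_neg, norm_mul]
  calc ‖inverseMills z‖ * ‖z * millsMoment 0 z - 1‖
      ≤ 2 * ‖z‖ * ‖z * millsMoment 0 z - 1‖ := by
        gcongr
        exact hK z hz hKz
    _ ≤ 2 * C := by
        rw [mul_assoc]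
        gcongr
        exact hC z hz

theorem iteratedDeriv_inverseMills_sub_id {n : ℕ} (hn : 1 ≤ n) {z : ℂ} (hz : 0 < z.re) :
    iteratedDeriv n (fun w => inverseMills w - w) z =
      iteratedDeriv n inverseMills z - (if n = 1 then 1 else 0) := by
  have h := iteratedDeriv_fun_sub (n := n) (x := z) (f := inverseMills) (g := fun w => w)
    (analyticAt_inverseMills hz).contDiffAt contDiffAt_id
  rw [h]
  congr 1
  rw [iteratedDeriv_fun_id, if_neg (by omega)]

theorem tendsto_norm_iteratedDeriv_inverseMills_sub {n : ℕ} (hn : 1 ≤ n) :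
    Tendsto
      (fun z : ℂ =>
        ‖iteratedDeriv n inverseMills z - (if n = 1 then 1 else 0)‖ / (‖z‖ / z.re ^ n))
      (comap Complex.re atTop) (𝓝 0) := by
  obtain ⟨C, K, hC, hK, H⟩ := exists_norm_inverseMills_sub_le
  have hlim : Tendsto (fun z : ℂ => n.factorial * C * 2 ^ n / z.re) (comap Complex.re atTop)
      (𝓝 0) := tendsto_const_nhds.div_atTop tendsto_comap
  refine squeeze_zero' ?_ ?_ hlim
  · filter_upwards [tendsto_comap.eventually_gt_atTop 0] with z hz
    positivity
  · filter_upwards [tendsto_comap.eventually_ge_atTop (2 * K)] with z hz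
    have hz0 : 0 < z.re := by linarith
    have hzn : z.re ≤ ‖z‖ := Complex.re_le_norm z
    -- Radius x/2 keeps the circle in Re w ≥ x/2 ≥ K, where |R(w) − w| ≤ C regardless of Im z. The
    -- final gain 1/x comes from x ≤ |z|.
    have hdiff : DiffContOnCl ℂ (fun w => inverseMills w - w) (ball z (z.re / 2)) :=
      (diffContOnCl_inverseMills (by linarith)).sub differentiable_id.diffContOnCl
    have h := Complex.norm_iteratedDeriv_le_of_forall_mem_sphere_norm_le n (half_pos hz0) hdiff
      (C := C) fun w hw => by
        have := re_nonneg_of_mem_closedBall (sphere_subset_closedBall hw)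
        exact H w (by linarith) (le_trans (by linarith) (Complex.re_le_norm w))
    rw [iteratedDeriv_inverseMills_sub_id hn hz0] at h
    have hz1 : 0 < ‖z‖ := hz0.trans_le hzn
    rw [div_le_iff₀ (by positivity)]
    refine h.trans ?_
    calc n.factorial * C / (z.re / 2) ^ n = n.factorial * C * 2 ^ n / z.re * (z.re / z.re ^ n) := by
          rw [div_pow]
          field_simp
      _ ≤ n.factorial * C * 2 ^ n / z.re * (‖z‖ / z.re ^ n) := by gcongr

end

theorem corollary4 :
    -- the inverse Mills ratio is well defined and holomorphic where it is differentiated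
    (∀ z : ℂ, 0 < z.re → normalTail z ≠ 0 ∧ AnalyticAt ℂ inverseMills z) ∧
    -- the bound on the derivatives
    (∀ n : ℕ, ∀ z : ℂ, 0 < z.re →
      ‖iteratedDeriv n inverseMills z‖ ≤
        (n.factorial : ℝ) / z.re ^ n *
          Real.sqrt (‖z + (Real.sqrt (2 / Real.pi) : ℂ)‖ ^ 2 + z.re ^ 2)) ∧
    -- the asymptotic relation, as `Re z → ∞` (uniformly in `Im z`)
    (∀ n : ℕ, 1 ≤ n →
      Tendsto
        (fun z : ℂ =>
          ‖iteratedDeriv n inverseMills z - (if n = 1 then 1 else 0)‖ / (‖z‖ / z.re ^ n))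
        (comap Complex.re atTop) (𝓝 0)) := by
  refine ⟨fun z hz => ⟨?_, analyticAt_inverseMills hz⟩,
    fun n z hz => norm_iteratedDeriv_inverseMills_le n hz,
    fun n hn => tendsto_norm_iteratedDeriv_inverseMills_sub hn⟩
  rw [normalTail_eq]
  exact mul_ne_zero (normalDensity_ne_zero z) (MillsMoment.ne_zero hz.le)
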